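/- Let $R$ be a profinite ring with unity, i.e. a (not necessarily commutative) compact, Hausdorff, totally disconnected topological ring with $1$. An étale space of (right, discrete) $R$-modules $(\mathcal A,p,X)$ consists of a topological space $\mathcal A$, a profinite space $X$, a local homeomorphism $p\colon\mathcal A\to X$, and a right $R$-module structure on each fibre $A_x=p^{-1}(x)$, such that the zero section $X\to\mathcal A$, $x\mapsto 0_x$, the fibrewise addition $\mathcal A\times_X\mathcal A\to\mathcal A$ and the action $\mathcal A\times R\to\mathcal A$ are continuous (each fibre is then a discrete $R$-module). A morphism $(\mathcal A,p,X)\to(\mathcal B,q,Y)$ is a pair $(\phi,f)$ of continuous maps $f\colon Y\to X$ and $\phi\colon\mathcal A\times_X Y\to\mathcal B$ such that, for each $y\in Y$, $\phi$ restricts to a morphism of $R$-modules $A_{f(y)}\times\{y\}\to B_y$. The composite of $(\phi,f)\colon(\mathcal A,p,X)\to(\mathcal B,q,Y)$ and $(\psi,g)\colon(\mathcal B,q,Y)\to(\mathcal C,r,Z)$ is given by $f\circ g$ and $(a,z)\mapsto\psi(\phi(a,g(z)),z)$. Call $(\mathcal A,p,X)$ finite if the set $\mathcal A$ is finite (then $X$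 is finite too). Then every étale space of $R$-modules is a direct limit of finite étale spaces of $R$-modules: for every étale space $\mathcal A$ of $R$-modules there are a nonempty directed partially ordered set $J$, a functor $j\mapsto\mathcal A_j$ from $J$ to the category of étale spaces of $R$-modules with every $\mathcal A_j$ finite, and morphisms $\mathcal A_j\to\mathcal A$ exhibiting $\mathcal A$ as the colimit of this diagram in the category of étale spaces of $R$-modules. -/

import Mathlib

open CategoryTheory

universe u v

/-- An étale space of right `R`-modules: a local homeomorphism `proj : total → base` onto a profinite
space, whose fibres are right `R`-modules (that is, `Rᵐᵒᵖ`-modules), such that the zero section, the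
addition `total ×_base total → total` and the action `total × R → total` are continuous. (The total
space is not assumed to be Hausdorff.) -/
structure EtaleModule (R : Type u) [Ring R] [TopologicalSpace R] where
  base : Profinite.{v}
  total : Type v
  [topology : TopologicalSpace total]
  proj : total → base
  isLocalHomeomorph_proj : IsLocalHomeomorph proj
  [addCommGroup : ∀ x : base, AddCommGroup {a : total // proj a = x}]
  [module : ∀ x : base, Module Rᵐᵒᵖ {a : total // proj a = x}]
  continuous_zero : Continuous fun x : base => ((0 : {a : total // proj a = x}) : total)
  continuous_add : Continuous fun z : {z : total × total // proj z.1 = proj z.2} =>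
    (((⟨z.1.1, rfl⟩ : {a : total // proj a = proj z.1.1}) + ⟨z.1.2, z.2.symm⟩ :
      {a : total // proj a = proj z.1.1}) : total)
  continuous_smul : Continuous fun z : total × R =>
    ((MulOpposite.op z.2 • (⟨z.1, rfl⟩ : {a : total // proj a = proj z.1}) :
      {a : total // proj a = proj z.1}) : total)

namespace EtaleModule

attribute [instance] EtaleModule.topology EtaleModule.addCommGroup EtaleModule.module

variable {R : Type u} [Ring R] [TopologicalSpace R]

/-- The fibre `A_x` of an étale space of modules, with the subspace topology. -/
abbrev Fibre (A : EtaleModule.{u, v} R) (x : A.base) : Type v := {a : A.total // A.proj a = x}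

/-- The fibres are automatically discrete. -/
theorem discreteTopology_fibre (A : EtaleModule.{u, v} R) (x : A.base) :
    DiscreteTopology (A.Fibre x) := by
  have h : IsLocalHomeomorphOn A.proj {a | A.proj a = x} := fun a _ => A.isLocalHomeomorph_proj a
  have : Subsingleton (A.proj '' {a | A.proj a = x}) := by
    refine ⟨?_⟩
    rintro ⟨_, a, ha, rfl⟩ ⟨_, b, hb, rfl⟩
    exact Subtype.ext (Eq.trans ha (Eq.symm hb))
  exact h.discreteTopology_of_image

/-- The fibres are automatically topological modules, hence discrete `R`-modules. -/
theorem continuousSMul_fibre (A : EtaleModule.{u, v} R) (x : A.base) :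
    ContinuousSMul Rᵐᵒᵖ (A.Fibre x) := by
  refine ⟨continuous_induced_rng.2 ?_⟩
  have h : Continuous fun z : Rᵐᵒᵖ × A.Fibre x => ((z.2 : A.total), z.1.unop) := by fun_prop
  refine (A.continuous_smul.comp h).congr ?_
  rintro ⟨r, a, rfl⟩
  rfl

/-- A morphism `(φ, f) : (A, p, X) → (B, q, Y)`: a continuous map `f : Y → X` together with a
continuous map `φ : A ×_X Y → B` which restricts to an `R`-linear map `A_{f(y)} → B_y` for every `y`.
The map `φ` is recorded through these restrictions, so that `φ (a, y) = fibreMap y a`. -/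
@[ext]
structure Hom (A B : EtaleModule.{u, v} R) where
  baseMap : C(B.base, A.base)
  fibreMap : ∀ y : B.base, A.Fibre (baseMap y) →ₗ[Rᵐᵒᵖ] B.Fibre y
  continuous_fibreMap : Continuous fun z : {z : A.total × B.base // A.proj z.1 = baseMap z.2} =>
    (fibreMap z.1.2 ⟨z.1.1, z.2⟩ : B.total)

/-- The identity morphism. -/
def Hom.id (A : EtaleModule.{u, v} R) : Hom A A where
  baseMap := ContinuousMap.id _
  fibreMap _ := LinearMap.id
  continuous_fibreMap := continuous_fst.comp continuous_subtype_val

/-- Composition of `(φ, f) : (A, p, X) → (B, q, Y)` and `(ψ, g) : (B, q, Y) → (C, r, Z)`: the map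
`f ∘ g : Z → X` together with `(a, z) ↦ ψ (φ (a, g z), z)`. -/
def Hom.comp {A B C : EtaleModule.{u, v} R} (φ : Hom A B) (ψ : Hom B C) : Hom A C where
  baseMap := φ.baseMap.comp ψ.baseMap
  fibreMap z := (ψ.fibreMap z).comp (φ.fibreMap (ψ.baseMap z))
  continuous_fibreMap := by
    have h1 : Continuous fun w : {w : A.total × C.base //
        A.proj w.1 = (φ.baseMap.comp ψ.baseMap) w.2} =>
        (φ.fibreMap (ψ.baseMap w.1.2) ⟨w.1.1, w.2⟩ : B.total) :=
      φ.continuous_fibreMap.comp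
        (Continuous.subtype_mk (f := fun w : {w : A.total × C.base //
          A.proj w.1 = (φ.baseMap.comp ψ.baseMap) w.2} => (w.1.1, ψ.baseMap w.1.2))
          (by fun_prop) fun w => w.2)
    exact ψ.continuous_fibreMap.comp
      (Continuous.subtype_mk (h1.prodMk (continuous_snd.comp continuous_subtype_val))
        fun w => (φ.fibreMap (ψ.baseMap w.1.2) ⟨w.1.1, w.2⟩).2)

/-- The category of étale spaces of right `R`-modules. -/
instance category : Category.{v} (EtaleModule.{u, v} R) where
  Hom := Hom
  id := Hom.id
  comp := Hom.comp

/-- An étale space of modules is finite if its total space is finite (the base, which embeds into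
the total space through the zero section, is then finite as well). -/
def IsFinite (A : EtaleModule.{u, v} R) : Prop := Finite A.total

end EtaleModule

/-!
Since the base `X` of an étale space `A` is profinite, every element of `A` is the value of a global
section, so `A` is determined by `X` and the module `Γ(X, A)`: a morphism `A → B` amounts to a map
`f : Y → X` and a linear map `g : Γ(X, A) → Γ(Y, B)` such that `g s` vanishes at `y` whenever `s`
vanishes at `f y`. Now `X` is the limit of its finite discrete quotients. On the other side, the
orbit map `r ↦ s r` of a global section `s` is locally constant because `X` is compact, hence has
finite image because `R` is compact, so `Γ(X, A)` is the directed union of its finite submodules. A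
discrete quotient `Q` of `X` and a finite submodule `M` of `Γ(X, A)` give a finite étale space over
`Q`, whose fibre at a class consists of the restrictions to that class of the sections in `M`.

A cocone under these finite étale spaces yields `f` and `g` in the limit. If `s` vanishes at `f y`,
it vanishes on a clopen neighbourhood of `f y`, that is, on a class of some `Q`, so already its
image over `Q` is zero there. This gives the vanishing of `g s` at `y`.
-/

section General

theorem isLocalHomeomorph_of_discreteTopology {X Y : Type*} [TopologicalSpace X]
    [TopologicalSpace Y] [DiscreteTopology X] [DiscreteTopology Y] (f : X → Y) :
    IsLocalHomeomorph f :=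
  isLocalHomeomorph_iff_isOpenEmbedding_restrict.2 fun x =>
    ⟨{x}, (isOpen_discrete _).mem_nhds rfl, .of_continuous_injective_isOpenMap
      continuous_of_discreteTopology (Function.injective_of_subsingleton _)
      fun _ _ => isOpen_discrete _⟩

theorem exists_continuousMap_of_compat {X Y : Type*} [TopologicalSpace X] [CompactSpace X]
    [T2Space X] [TotallyDisconnectedSpace X] [TopologicalSpace Y]
    (g : ∀ Q : DiscreteQuotient X, C(Y, Q))
    (hg : ∀ (P Q : DiscreteQuotient X) (h : P ≤ Q) (y : Y),
      DiscreteQuotient.ofLE h (g P y) = g Q y) :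
    ∃ f : C(Y, X), ∀ Q y, DiscreteQuotient.proj Q (f y) = g Q y := by
  choose f hf using fun y =>
    DiscreteQuotient.exists_of_compat (fun Q => g Q y) fun P Q h => hg P Q h y
  refine ⟨⟨f, isTopologicalBasis_isClopen.continuous_iff.2 fun C hC => ?_⟩, fun Q y => hf y Q⟩
  let Q := DiscreteQuotient.ofIsClopen hC
  have preimage_eq : f ⁻¹' C = g Q ⁻¹' (Q.proj '' C) := by
    ext y
    rw [Set.mem_preimage, Set.mem_preimage, ← hf y Q]
    refine ⟨Set.mem_image_of_mem _, ?_⟩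
    rintro ⟨x, hx, hxy⟩
    exact (Quotient.exact hxy).1 hx
  rw [preimage_eq]
  exact (isOpen_discrete _).preimage (g Q).continuous

theorem finite_submodule_sup {S E : Type*} [Semiring S] [AddCommMonoid E] [Module S E]
    (M N : Submodule S E) [Finite M] [Finite N] : Finite (M ⊔ N : Submodule S E) :=
  have : ((M ⊔ N : Submodule S E) : Set E).Finite :=
    Submodule.coe_sup M N ▸ (Set.toFinite (M : Set E)).add (Set.toFinite (N : Set E))
  this

variable {S E F : Type*} [Ring S] [AddCommGroup E] [Module S E] [AddCommGroup F] [Module S F]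

theorem exists_linearMap_of_directed {ι : Type*} [Preorder ι] [IsDirectedOrder ι]
    {M : ι → Submodule S E} (hM : Monotone M) (cover : ∀ e, ∃ i, e ∈ M i)
    (f : ∀ i, M i →ₗ[S] F)
    (compat : ∀ (i j : ι) (h : i ≤ j), f j ∘ₗ Submodule.inclusion (hM h) = f i) :
    ∃ g : E →ₗ[S] F, ∀ i, g ∘ₗ (M i).subtype = f i := by
  let p (i : ι) : E →ₗ.[S] F := ⟨M i, f i⟩
  have p_mono : Monotone p := fun i j h => ⟨hM h, fun x y hxy => by
    rw [show y = Submodule.inclusion (hM h) x from Subtype.ext hxy.symm]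
    exact (LinearMap.congr_fun (compat i j h) x).symm⟩
  have directed : DirectedOn (· ≤ ·) (Set.range p) :=
    directedOn_range.2 p_mono.directed_le
  have mem_domain (e : E) : e ∈ (LinearPMap.sSup _ directed).domain := by
    obtain ⟨i, hi⟩ := cover e
    exact (LinearPMap.mem_domain_sSup_iff ⟨_, Set.mem_range_self i⟩ directed).2
      ⟨p i, Set.mem_range_self i, hi⟩
  refine ⟨(LinearPMap.sSup _ directed).toFun ∘ₗ LinearMap.id.codRestrict _ mem_domain, fun i => ?_⟩
  ext x
  exact LinearPMap.sSup_apply directed ⟨i, rfl⟩ x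

/-- The linear map that `ψ` induces on the target of a surjection `π` whose kernel it kills. -/
noncomputable def linearMapLiftOfSurjective {P : Type*} [AddCommGroup P] [Module S P]
    (π : E →ₗ[S] P) (hπ : Function.Surjective π) (ψ : E →ₗ[S] F)
    (h : LinearMap.ker π ≤ LinearMap.ker ψ) : P →ₗ[S] F :=
  (LinearMap.ker π).liftQ ψ h ∘ₗ (π.quotKerEquivOfSurjective hπ).symm.toLinearMap

theorem linearMapLiftOfSurjective_apply {P : Type*} [AddCommGroup P] [Module S P]
    (π : E →ₗ[S] P) (hπ : Function.Surjective π) (ψ : E →ₗ[S] F)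
    (h : LinearMap.ker π ≤ LinearMap.ker ψ) (e : E) :
    linearMapLiftOfSurjective π hπ ψ h (π e) = ψ e := by
  simp only [linearMapLiftOfSurjective, LinearMap.comp_apply, LinearEquiv.coe_coe,
    LinearMap.quotKerEquivOfSurjective_symm_apply, Submodule.liftQ_apply]

end General

namespace EtaleModule

variable {R : Type u} [Ring R] [TopologicalSpace R]

section Sections

variable {A : EtaleModule.{u, v} R} {T : Type*} [TopologicalSpace T] {f : T → A.base}

theorem continuous_fibre_add {s t : ∀ z, A.Fibre (f z)}
    (hs : Continuous fun z => (s z : A.total)) (ht : Continuous fun z => (t z : A.total)) :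
    Continuous fun z => ((s z + t z : A.Fibre (f z)) : A.total) := by
  have coe_add {x : A.base} (a b : A.Fibre x) (h : A.proj b.1 = A.proj a.1) :
      (((⟨a.1, rfl⟩ : A.Fibre (A.proj a.1)) + ⟨b.1, h⟩ : A.Fibre (A.proj a.1)) : A.total) =
        (a + b : A.Fibre x) := by
    obtain ⟨a, rfl⟩ := a
    rfl
  exact (A.continuous_add.comp ((hs.prodMk ht).subtype_mk
    fun z => (s z).2.trans (t z).2.symm)).congr fun z => coe_add (s z) (t z) _

theorem continuous_fibre_smul {s : ∀ z, A.Fibre (f z)} {r : T → R}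
    (hs : Continuous fun z => (s z : A.total)) (hr : Continuous r) :
    Continuous fun z => ((MulOpposite.op (r z) • s z : A.Fibre (f z)) : A.total) := by
  have coe_smul {x : A.base} (a : A.Fibre x) (r : R) :
      ((MulOpposite.op r • (⟨a.1, rfl⟩ : A.Fibre (A.proj a.1)) : A.Fibre (A.proj a.1)) : A.total) =
        (MulOpposite.op r • a : A.Fibre x) := by
    obtain ⟨a, rfl⟩ := a
    rfl
  exact (A.continuous_smul.comp (hs.prodMk hr)).congr fun z => coe_smul (s z) (r z)

theorem isOpen_setOf_fibre_eq {s t : ∀ z, A.Fibre (f z)}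
    (hs : Continuous fun z => (s z : A.total)) (ht : Continuous fun z => (t z : A.total)) :
    IsOpen {z | s z = t z} := by
  simpa only [Subtype.ext_iff] using A.isLocalHomeomorph_proj.isLocallyInjective.isOpen_eqLocus
    hs ht (funext fun z => (s z).2.trans (t z).2.symm)

variable (A) in
/-- The module `Γ(X, A)` of continuous global sections, inside the product of all fibres. -/
def sections : Submodule Rᵐᵒᵖ (∀ x, A.Fibre x) where
  carrier := {s | Continuous fun x => (s x : A.total)}
  zero_mem' := A.continuous_zero
  add_mem' := continuous_fibre_add
  smul_mem' r _ hs := continuous_fibre_smul (r := fun _ => r.unop) hs continuous_const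

theorem continuous_section (s : A.sections) : Continuous fun x => (s.1 x : A.total) := s.2

theorem isOpen_setOf_section_eq (s t : A.sections) : IsOpen {x | s.1 x = t.1 x} :=
  isOpen_setOf_fibre_eq (continuous_section s) (continuous_section t)

theorem exists_section_extending_by_zero {U : Set A.base} (hU : IsClopen U) (σ : A.base → A.total)
    (hσ : ContinuousOn σ U) (hσp : ∀ x ∈ U, A.proj (σ x) = x) :
    ∃ s : A.sections, ∀ x ∈ U, (s.1 x : A.total) = σ x := by
  classical
  let s (x : A.base) : A.Fibre x := if h : x ∈ U then ⟨σ x, hσp x h⟩ else 0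
  have s_eq : ∀ x ∈ U, (s x : A.total) = σ x := fun x hx => by simp only [s, dif_pos hx]
  have s_eq_zero : ∀ x ∈ Uᶜ, s x = 0 := fun x hx => dif_neg hx
  have continuous_s : Continuous fun x => (s x : A.total) := by
    rw [← continuousOn_univ, ← Set.union_compl_self U]
    exact (hσ.congr s_eq).union_of_isOpen
      (A.continuous_zero.continuousOn.congr fun x hx => congrArg Subtype.val (s_eq_zero x hx))
      hU.isOpen hU.compl.isOpen
  exact ⟨⟨s, continuous_s⟩, s_eq⟩

theorem exists_section_eq {x : A.base} (a : A.Fibre x) : ∃ s : A.sections, s.1 x = a := by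
  obtain ⟨a, rfl⟩ := a
  let e := A.isLocalHomeomorph_proj.localInverseAt a
  obtain ⟨U, hU, hxU, hUe⟩ := compact_exists_isClopen_in_isOpen e.open_source
    A.isLocalHomeomorph_proj.apply_self_mem_localInverseAt_source
  obtain ⟨s, hs⟩ := exists_section_extending_by_zero hU e (e.continuousOn.mono hUe)
    fun x hx => A.isLocalHomeomorph_proj.apply_localInverseAt_of_mem (hUe hx)
  exact ⟨s, Subtype.ext ((hs _ hxU).trans A.isLocalHomeomorph_proj.localInverseAt_apply_self)⟩

theorem exists_isClopen_section_eq_zero {s : A.sections} {x : A.base} (hs : s.1 x = 0) :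
    ∃ C : Set A.base, IsClopen C ∧ x ∈ C ∧ ∀ x' ∈ C, s.1 x' = 0 :=
  compact_exists_isClopen_in_isOpen (isOpen_setOf_section_eq s 0) hs

theorem isLocallyConstant_smul_section (s : A.sections) :
    IsLocallyConstant fun r : R => MulOpposite.op r • s := by
  refine (IsLocallyConstant.iff_eventually_eq _).2 fun r₀ => ?_
  have isOpen_agree : IsOpen {z : R × A.base |
      MulOpposite.op z.1 • s.1 z.2 = MulOpposite.op r₀ • s.1 z.2} :=
    have continuous_s := (continuous_section s).comp continuous_snd
    isOpen_setOf_fibre_eq (f := Prod.snd) (continuous_fibre_smul continuous_s continuous_fst)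
      (continuous_fibre_smul continuous_s continuous_const)
  have eventually_agree : ∀ᶠ r in nhds r₀, ∀ x ∈ Set.univ,
      MulOpposite.op r • s.1 x = MulOpposite.op r₀ • s.1 x :=
    isCompact_univ.eventually_forall_of_forall_eventually fun x _ =>
      isOpen_agree.mem_nhds (x := (r₀, x)) rfl
  filter_upwards [eventually_agree] with r hr
  exact Subtype.ext (funext fun x => hr x trivial)

theorem finite_span_singleton [CompactSpace R] (s : A.sections) :
    Finite (Submodule.span Rᵐᵒᵖ {s}) := by
  have span_subset : (Submodule.span Rᵐᵒᵖ {s} : Set A.sections) ⊆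
      Set.range fun r : R => MulOpposite.op r • s := fun t ht => by
    obtain ⟨r, rfl⟩ := Submodule.mem_span_singleton.1 ht
    exact ⟨r.unop, rfl⟩
  exact (isLocallyConstant_smul_section s).range_finite.subset span_subset

variable (A) in
/-- Restriction of global sections to a subset of the base. -/
def restrictSections (C : Set A.base) : A.sections →ₗ[Rᵐᵒᵖ] ∀ x : C, A.Fibre x :=
  LinearMap.pi fun x => LinearMap.proj x.1 ∘ₗ A.sections.subtype

end Sections

section Morphisms

variable {A B C : EtaleModule.{u, v} R}

/-- The map `Γ(X, A) → Γ(Y, B)` induced by a morphism, sending `s` to `y ↦ φ (s (f y), y)`. -/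
def Hom.mapSections (φ : Hom A B) : A.sections →ₗ[Rᵐᵒᵖ] B.sections where
  toFun s := ⟨fun y => φ.fibreMap y (s.1 _), φ.continuous_fibreMap.comp
    ((((continuous_section s).comp φ.baseMap.continuous).prodMk continuous_id).subtype_mk
      fun y => (s.1 (φ.baseMap y)).2)⟩
  map_add' s t := Subtype.ext (funext fun y => map_add (φ.fibreMap y) (s.1 _) (t.1 _))
  map_smul' r s := Subtype.ext (funext fun y => map_smul (φ.fibreMap y) r (s.1 _))

theorem mapSections_comp (φ : A ⟶ B) (ψ : B ⟶ C) :
    Hom.mapSections (φ ≫ ψ) = ψ.mapSections ∘ₗ φ.mapSections :=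
  rfl

variable {S : Type*} [AddCommGroup S] [Module Rᵐᵒᵖ S] {σ : S →ₗ[Rᵐᵒᵖ] A.sections}

/-- A linear family `σ` of global sections generates `A` if its values fill up every fibre. -/
def Generates (σ : S →ₗ[Rᵐᵒᵖ] A.sections) : Prop :=
  ∀ x, Function.Surjective fun s => (σ s).1 x

theorem generates_id : Generates (LinearMap.id : A.sections →ₗ[Rᵐᵒᵖ] A.sections) :=
  fun _ => exists_section_eq

theorem Generates.hom_ext (hσ : Generates σ) {φ φ' : A ⟶ B} (hbase : φ.baseMap = φ'.baseMap)
    (hsections : φ.mapSections ∘ₗ σ = φ'.mapSections ∘ₗ σ) : φ = φ' := by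
  obtain ⟨f, l, _⟩ := φ
  obtain ⟨f', l', _⟩ := φ'
  obtain rfl : f = f' := hbase
  congr
  funext y
  ext a : 1
  obtain ⟨s, rfl⟩ := hσ _ a
  exact congrFun (congrArg Subtype.val (LinearMap.congr_fun hsections s)) y

variable (hσ : Generates σ) (f : C(B.base, A.base)) (ψ : S →ₗ[Rᵐᵒᵖ] B.sections)
  (h : ∀ y s, (σ s).1 (f y) = 0 → (ψ s).1 y = 0)

/-- The linear map `A_{f(y)} → B_y` sending the value at `f y` of each generating section `σ s` to
the value at `y` of `ψ s`. -/
noncomputable def Generates.fibreMap (y : B.base) : A.Fibre (f y) →ₗ[Rᵐᵒᵖ] B.Fibre y :=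
  linearMapLiftOfSurjective (LinearMap.proj (f y) ∘ₗ A.sections.subtype ∘ₗ σ) (hσ _)
    (LinearMap.proj y ∘ₗ B.sections.subtype ∘ₗ ψ) (h y)

theorem Generates.fibreMap_section (y : B.base) (s : S) :
    hσ.fibreMap f ψ h y ((σ s).1 (f y)) = (ψ s).1 y :=
  linearMapLiftOfSurjective_apply _ (hσ _) _ (h y) s

/-- Morphisms out of `A` are built from generating sections: `σ s` is sent to `ψ s`. -/
noncomputable def Generates.hom : A ⟶ B where
  baseMap := f
  fibreMap := hσ.fibreMap f ψ h
  continuous_fibreMap := by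
    refine continuous_iff_continuousAt.2 fun ⟨⟨a₀, y₀⟩, h₀⟩ => ?_
    obtain ⟨s, hs⟩ := hσ _ ⟨a₀, h₀⟩
    have continuous_base : Continuous fun z : {z : A.total × B.base // A.proj z.1 = f z.2} =>
      z.1.2 := continuous_snd.comp continuous_subtype_val
    have isOpen_agree : IsOpen {z : {z : A.total × B.base // A.proj z.1 = f z.2} |
        (σ s).1 (f z.1.2) = ⟨z.1.1, z.2⟩} :=
      isOpen_setOf_fibre_eq
        ((continuous_section (σ s)).comp (f.continuous.comp continuous_base))
        (continuous_fst.comp continuous_subtype_val)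
    refine ((continuous_section (ψ s)).comp continuous_base).continuousAt.congr ?_
    filter_upwards [isOpen_agree.mem_nhds hs] with z hz
    exact congrArg Subtype.val
      ((hσ.fibreMap_section f ψ h z.1.2 s).symm.trans (congrArg (hσ.fibreMap f ψ h z.1.2) hz))

theorem Generates.mapSections_hom : (hσ.hom f ψ h).mapSections ∘ₗ σ = ψ :=
  LinearMap.ext fun s => Subtype.ext (funext fun y => hσ.fibreMap_section f ψ h y s)

end Morphisms

section OfFamily

variable (Q : Type v) [TopologicalSpace Q] [DiscreteTopology Q] [Finite Q]
  (N : Q → Type v) [∀ q, AddCommGroup (N q)] [∀ q, Module Rᵐᵒᵖ (N q)]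
  (hN : ∀ q (n : N q), IsLocallyConstant fun r : R => MulOpposite.op r • n)

/-- The étale space over a finite discrete space `Q` with fibres `N q`, where `hN` says that the
modules `N q` are discrete. The total space is the disjoint union of the fibres, with the discrete
topology. -/
def ofFamily : EtaleModule.{u, v} R :=
  letI : TopologicalSpace (Σ q, N q) := ⊥
  haveI : DiscreteTopology (Σ q, N q) := ⟨rfl⟩
  letI (q : Q) : AddCommGroup {a : Σ q, N q // a.1 = q} := (Equiv.sigmaSubtype q).addCommGroup
  { base := Profinite.of Q
    total := Σ q, N q
    topology := ⊥
    proj := Sigma.fst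
    isLocalHomeomorph_proj := isLocalHomeomorph_of_discreteTopology (Y := Q) _
    addCommGroup := this
    module := fun q => (Equiv.sigmaSubtype q).module Rᵐᵒᵖ
    continuous_zero := continuous_of_discreteTopology (α := Q)
    continuous_add := continuous_of_discreteTopology
    continuous_smul := continuous_prod_of_discrete_left.2 fun ⟨q, n⟩ =>
      ((hN q n).comp (Sigma.mk q)).continuous }

/-- A family of elements of the modules `N q` as a section of `ofFamily Q N hN`. -/
def sectionOfFamily : (∀ q, N q) →ₗ[Rᵐᵒᵖ] (ofFamily Q N hN).sections where
  toFun n := ⟨fun q => ⟨⟨q, n q⟩, rfl⟩, continuous_of_discreteTopology (α := Q)⟩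
  map_add' _ _ := rfl
  map_smul' _ _ := rfl

variable {Q N hN}

-- `q` is a point of `Q` only by unfolding `ofFamily`, so the zero of `N q` comes from the product.
theorem sectionOfFamily_eq_zero_iff {n : ∀ q, N q} {q : (ofFamily Q N hN).base} :
    (sectionOfFamily Q N hN n).1 q = 0 ↔ n q = (0 : ∀ q, N q) q :=
  (Equiv.sigmaSubtype (β := N) q).symm.injective.eq_iff (a := n q) (b := (0 : ∀ q, N q) q)

theorem generates_sectionOfFamily_pi {S : Type*} [AddCommGroup S] [Module Rᵐᵒᵖ S]
    {σ : ∀ q, S →ₗ[Rᵐᵒᵖ] N q} (hσ : ∀ q, Function.Surjective (σ q)) :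
    Generates (sectionOfFamily Q N hN ∘ₗ LinearMap.pi σ) := by
  rintro _ ⟨⟨q, n⟩, rfl⟩
  obtain ⟨s, rfl⟩ := hσ q n
  exact ⟨s, rfl⟩

end OfFamily

section Stage

variable (A : EtaleModule.{u, v} R)

/-- The index of a finite approximation to `A`: a discrete quotient of the base, ordered by
refinement, and a finite module of global sections, ordered by inclusion. -/
structure StageIndex : Type v where
  quot : DiscreteQuotient A.base
  mod : Submodule Rᵐᵒᵖ A.sections
  [finite_mod : Finite mod]

namespace StageIndex

attribute [instance] StageIndex.finite_mod

variable {A}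

instance : PartialOrder A.StageIndex where
  le i j := j.quot ≤ i.quot ∧ i.mod ≤ j.mod
  le_refl _ := ⟨le_rfl, le_rfl⟩
  le_trans _ _ _ h h' := ⟨h'.1.trans h.1, h.2.trans h'.2⟩
  le_antisymm := by
    rintro ⟨P, M⟩ ⟨Q, N⟩ h h'
    obtain rfl : P = Q := h'.1.antisymm h.1
    obtain rfl : M = N := h.2.antisymm h'.2
    rfl

theorem monotone_mod : Monotone (mod : A.StageIndex → Submodule Rᵐᵒᵖ A.sections) :=
  fun _ _ h => h.2

instance : Nonempty A.StageIndex :=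
  ⟨⟨⊤, ⊥⟩⟩

instance : IsDirectedOrder A.StageIndex where
  directed i j :=
    have := finite_submodule_sup i.mod j.mod
    ⟨⟨i.quot ⊓ j.quot, i.mod ⊔ j.mod⟩, ⟨inf_le_left, le_sup_left⟩, ⟨inf_le_right, le_sup_right⟩⟩

variable (i j : A.StageIndex)

theorem isLocallyConstant_smul_restriction (q : j.quot)
    (m : j.mod.map (A.restrictSections (j.quot.proj ⁻¹' {q}))) :
    IsLocallyConstant fun r : R => MulOpposite.op r • m := by
  obtain ⟨_, s, -, rfl⟩ := m
  exact .desc _ Subtype.val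
    ((isLocallyConstant_smul_section s).comp (A.restrictSections (j.quot.proj ⁻¹' {q})))
    Subtype.val_injective

/-- The finite étale space over `j.quot` whose fibre at a class is the module of restrictions to
that class of the global sections in `j.mod`. -/
def stage : EtaleModule.{u, v} R :=
  ofFamily j.quot (fun q => j.mod.map (A.restrictSections (j.quot.proj ⁻¹' {q})))
    j.isLocallyConstant_smul_restriction

theorem isFinite_stage : j.stage.IsFinite := by
  have (q : j.quot) : Finite (j.mod.map (A.restrictSections (j.quot.proj ⁻¹' {q}))) :=
    Finite.of_surjective _ (LinearMap.submoduleMap_surjective _ j.mod)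
  exact inferInstanceAs (Finite (Σ q : j.quot,
    j.mod.map (A.restrictSections (j.quot.proj ⁻¹' {q}))))

/-- The global sections of a stage given by the elements of `j.mod`. -/
def stageSections : j.mod →ₗ[Rᵐᵒᵖ] j.stage.sections :=
  sectionOfFamily j.quot _ _ ∘ₗ LinearMap.pi fun _ => (A.restrictSections _).submoduleMap j.mod

theorem generates_stageSections : Generates (S := j.mod) j.stageSections :=
  generates_sectionOfFamily_pi fun _ => LinearMap.submoduleMap_surjective _ j.mod

variable {i j}

theorem stageSections_eq_zero_iff {s : j.mod} {q : j.stage.base} :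
    (j.stageSections s).1 q = 0 ↔ ∀ x, j.quot.proj x = q → s.1.1 x = 0 :=
  sectionOfFamily_eq_zero_iff.trans (Subtype.ext_iff.trans (funext_iff.trans Subtype.forall))

/-- The morphism from a stage to a finer one. -/
noncomputable def transition (h : i ≤ j) : i.stage ⟶ j.stage :=
  i.generates_stageSections.hom
    ⟨DiscreteQuotient.ofLE h.1, DiscreteQuotient.ofLE_continuous _⟩
    (j.stageSections ∘ₗ Submodule.inclusion h.2) fun _ _ hs =>
      stageSections_eq_zero_iff.2 fun x hx => stageSections_eq_zero_iff.1 hs x (hx ▸ rfl)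

theorem mapSections_transition (h : i ≤ j) :
    (transition h).mapSections ∘ₗ i.stageSections = j.stageSections ∘ₗ Submodule.inclusion h.2 :=
  i.generates_stageSections.mapSections_hom ..

variable (j) in
/-- The canonical morphism from a stage to the étale space it approximates. -/
noncomputable def toSpace : j.stage ⟶ A :=
  j.generates_stageSections.hom ⟨j.quot.proj, j.quot.proj_continuous⟩ j.mod.subtype
    fun x _ hs => stageSections_eq_zero_iff.1 hs x rfl

theorem mapSections_toSpace : j.toSpace.mapSections ∘ₗ j.stageSections = j.mod.subtype :=
  j.generates_stageSections.mapSections_hom ..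

theorem transition_comp_toSpace (h : i ≤ j) : transition h ≫ j.toSpace = i.toSpace :=
  i.generates_stageSections.hom_ext rfl <| by
    rw [mapSections_comp, LinearMap.comp_assoc, mapSections_transition, ← LinearMap.comp_assoc,
      mapSections_toSpace, mapSections_toSpace]
    rfl

end StageIndex

open StageIndex

/-- The directed system of the finite stages. -/
noncomputable def stageFunctor : A.StageIndex ⥤ EtaleModule.{u, v} R where
  obj := stage
  map h := transition (leOfHom h)
  map_id j := j.generates_stageSections.hom_ext (by ext ⟨x⟩; rfl) (mapSections_transition _)
  map_comp {i j k} f g := i.generates_stageSections.hom_ext (by ext ⟨x⟩; rfl) <| by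
    rw [mapSections_comp, LinearMap.comp_assoc, mapSections_transition, mapSections_transition,
      ← LinearMap.comp_assoc, mapSections_transition]
    rfl

/-- The cocone of the canonical morphisms from the finite stages to `A`. -/
noncomputable def stageCocone : A.stageFunctor ⟶ (Functor.const A.StageIndex).obj A where
  app j := j.toSpace
  naturality _ _ h := transition_comp_toSpace (leOfHom h)

end Stage

section Colimit

open StageIndex

variable {A : EtaleModule.{u, v} R} (c : Limits.Cocone A.stageFunctor)

/-- The components of a cocone under the finite stages. -/
abbrev coconeHom (j : A.StageIndex) : j.stage ⟶ c.pt := c.ι.app j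

variable {c} in
theorem transition_comp_coconeHom {i j : A.StageIndex} (h : i ≤ j) :
    transition h ≫ coconeHom c j = coconeHom c i :=
  c.w (homOfLE h)

theorem exists_baseMap_of_cocone : ∃ f : C(c.pt.base, A.base), ∀ (j : A.StageIndex) y,
    j.quot.proj (f y) = (coconeHom c j).baseMap y := by
  have baseMap_eq {i j : A.StageIndex} (h : i ≤ j) (y : c.pt.base) :
      DiscreteQuotient.ofLE h.1 ((coconeHom c j).baseMap y) = (coconeHom c i).baseMap y :=
    congrArg (fun φ : i.stage ⟶ c.pt => φ.baseMap y) (transition_comp_coconeHom h)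
  obtain ⟨f, hf⟩ := exists_continuousMap_of_compat
    (fun Q => (coconeHom c ⟨Q, ⊥⟩).baseMap)
    fun P Q h y => baseMap_eq (i := ⟨Q, ⊥⟩) (j := ⟨P, ⊥⟩) ⟨h, le_rfl⟩ y
  refine ⟨f, fun j y => (hf j.quot y).trans ?_⟩
  have h : ⟨j.quot, ⊥⟩ ≤ j := ⟨le_rfl, bot_le⟩
  exact (baseMap_eq h y).symm.trans (DiscreteQuotient.ofLE_refl_apply _)

variable [CompactSpace R]

/-- The index given by a discrete quotient and the finite module generated by one section. -/
def spanIndex (Q : DiscreteQuotient A.base) (s : A.sections) : A.StageIndex :=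
  have := finite_span_singleton s
  ⟨Q, Submodule.span Rᵐᵒᵖ {s}⟩

theorem mem_spanIndex (Q : DiscreteQuotient A.base) (s : A.sections) : s ∈ (spanIndex Q s).mod :=
  Submodule.mem_span_singleton_self s

theorem exists_sectionsMap_of_cocone : ∃ g : A.sections →ₗ[Rᵐᵒᵖ] c.pt.sections,
    ∀ j : A.StageIndex, g ∘ₗ j.mod.subtype = (coconeHom c j).mapSections ∘ₗ j.stageSections := by
  have cover (s : A.sections) : ∃ j : A.StageIndex, s ∈ j.mod :=
    ⟨spanIndex ⊤ s, mem_spanIndex ⊤ s⟩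
  refine exists_linearMap_of_directed monotone_mod cover
    (fun j => (coconeHom c j).mapSections ∘ₗ j.stageSections) fun i j h => ?_
  rw [← transition_comp_coconeHom h, mapSections_comp, LinearMap.comp_assoc, LinearMap.comp_assoc,
    mapSections_transition]

theorem exists_hom_of_cocone : ∃ φ : A ⟶ c.pt, ∀ j : A.StageIndex,
    j.toSpace ≫ φ = coconeHom c j := by
  obtain ⟨f, hf⟩ := exists_baseMap_of_cocone c
  obtain ⟨g, hg⟩ := exists_sectionsMap_of_cocone c
  have g_eq_zero (y : c.pt.base) (s : A.sections) (hs : s.1 (f y) = 0) : (g s).1 y = 0 := by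
    obtain ⟨C, hC, hyC, hsC⟩ := exists_isClopen_section_eq_zero hs
    let j := spanIndex (DiscreteQuotient.ofIsClopen hC) s
    let t : j.mod := ⟨s, mem_spanIndex _ s⟩
    have t_eq_zero : (j.stageSections t).1 ((coconeHom c j).baseMap y) = 0 :=
      stageSections_eq_zero_iff.2 fun x hx =>
        hsC x ((Quotient.exact (hx.trans (hf j y).symm)).2 hyC)
    rw [show g s = _ from LinearMap.congr_fun (hg j) t]
    exact (congrArg ((coconeHom c j).fibreMap y) t_eq_zero).trans (map_zero _)
  refine ⟨generates_id.hom f g g_eq_zero, fun j =>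
    j.generates_stageSections.hom_ext (ContinuousMap.ext (hf j)) ?_⟩
  rw [mapSections_comp, LinearMap.comp_assoc, mapSections_toSpace, ← hg j]
  exact congrArg (· ∘ₗ j.mod.subtype) (generates_id.mapSections_hom f g g_eq_zero)

theorem hom_ext_of_stages {B : EtaleModule.{u, v} R} {φ φ' : A ⟶ B}
    (h : ∀ j : A.StageIndex, j.toSpace ≫ φ = j.toSpace ≫ φ') : φ = φ' := by
  have comp_subtype_eq (j : A.StageIndex) :
      φ.mapSections ∘ₗ j.mod.subtype = φ'.mapSections ∘ₗ j.mod.subtype := by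
    rw [← mapSections_toSpace, ← LinearMap.comp_assoc, ← mapSections_comp, h, mapSections_comp,
      LinearMap.comp_assoc]
  refine generates_id.hom_ext (ContinuousMap.ext fun y =>
    DiscreteQuotient.eq_of_forall_proj_eq fun Q => ?_) (LinearMap.ext fun s => ?_)
  · exact congrArg (fun χ : stage ⟨Q, ⊥⟩ ⟶ B => χ.baseMap y) (h ⟨Q, ⊥⟩)
  · exact LinearMap.congr_fun (comp_subtype_eq (spanIndex ⊤ s)) ⟨s, mem_spanIndex ⊤ s⟩

variable (A) in
theorem nonempty_isColimit_stageCocone :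
    Nonempty (Limits.IsColimit (Limits.Cocone.mk A A.stageCocone)) :=
  ⟨.ofExistsUnique fun c =>
    have ⟨φ, hφ⟩ := exists_hom_of_cocone c
    ⟨φ, hφ, fun _ hφ' => hom_ext_of_stages fun j => (hφ' j).trans (hφ j).symm⟩⟩

end Colimit

end EtaleModule

theorem mainTheorem8_general {R : Type u} [Ring R] [TopologicalSpace R] [CompactSpace R]
    (A : EtaleModule.{u, v} R) :
    ∃ (J : Type v) (_ : PartialOrder J) (_ : Nonempty J) (_ : IsDirectedOrder J)
      (F : J ⥤ EtaleModule.{u, v} R) (ι : F ⟶ (Functor.const J).obj A),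
      (∀ j : J, (F.obj j).IsFinite) ∧ Nonempty (Limits.IsColimit (Limits.Cocone.mk A ι)) :=
  ⟨A.StageIndex, inferInstance, inferInstance, inferInstance, A.stageFunctor, A.stageCocone,
    EtaleModule.StageIndex.isFinite_stage, A.nonempty_isColimit_stageCocone⟩

theorem mainTheorem8 {R : Type u} [Ring R] [TopologicalSpace R] [IsTopologicalRing R]
    [CompactSpace R] [T2Space R] [TotallyDisconnectedSpace R] (A : EtaleModule.{u, v} R) :
    ∃ (J : Type v) (_ : PartialOrder J) (_ : Nonempty J) (_ : IsDirectedOrder J)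
      (F : J ⥤ EtaleModule.{u, v} R) (ι : F ⟶ (Functor.const J).obj A),
      (∀ j : J, (F.obj j).IsFinite) ∧ Nonempty (Limits.IsColimit (Limits.Cocone.mk A ι)) :=
  mainTheorem8_general A
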